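/- **Conventions.** A fuzzy order on a set $E$ is a map $\mu:E\times E\to[0,1]$ with $\mu(x,x)=1$; $\mu(x,y)+\mu(y,x)>1\Rightarrow x=y$; and $\mu(x,z)\ge\sup_{y\in E}\min(\mu(x,y),\mu(y,z))$. For $A\subseteq E$, an element $y$ is an upper (lower) bound of $A$ if $\mu(x,y)>\frac12$ (resp. $\mu(y,x)>\frac12$) for all $x\in A$; $z=\sup A$ means that $z$ is an upper bound of $A$ and $\mu(z,y)>\frac12$ for every upper bound $y$ of $A$; infima are defined dually. A fuzzy Riesz space is a real vector space $E$ with a fuzzy order $\mu$ in which any two elements have a supremum $x\vee y$ and an infimum $x\wedge y$, and such that $\mu(x_1,x_2)>\frac12$ implies $\mu(x_1,x_2)\le\mu(x_1+x,x_2+x)$ for all $x\in E$ and $\mu(x_1,x_2)\le\mu(\alpha x_1,\alpha x_2)$ for all real $\alpha>0$. Put $|x|=x\vee(-x)$ and $E^+=\{x:\mu(0,x)>\frac12\}$. $E$ is fuzzy Archimedean if for no nonzero $x\in E^+$ the set $\{\lambda x:\lambda>0\}$ is bounded above. A net $(x_\alpha)$ (indexed by a nonempty directed set) in $E$ is fuzzy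 order convergent to $x$ if there is a net $(y_\alpha)$ with the same index set such that $\mu(|x_\alpha-x|,y_\alpha)>\frac12$ for all $\alpha$, $\mu(y_\beta,y_\alpha)>\frac12$ whenever $\alpha\le\beta$, and $\inf_\alpha y_\alpha=0$. Let $F$ be another fuzzy Riesz space and $T:E\to F$ a linear operator. $T$ is fuzzy positive if $T(E^+)\subseteq F^+$; it is a fuzzy lattice homomorphism if $T(x\vee y)=Tx\vee Ty$ for all $x,y$; it is fuzzy order continuous (fuzzy $\sigma$-order continuous) if it maps nets (sequences) that are fuzzy order convergent to $0$ to nets (sequences) that are fuzzy order convergent to $0$. $E$ has the fuzzy order continuity property (fuzzy $\sigma$-order continuity property) if every fuzzy positive linear operator from $E$ into an arbitrary fuzzy Archimedean Riesz space is fuzzy order continuous (fuzzy $\sigma$-order continuous). $E$ has the fuzzy countable sup property if every $A\subseteq E$ having a supremum has an at most countable subset $B$ with $\sup B=\sup A$. A fuzzy ideal is a linear subspace $A$ of $E$ such that $\mu(|x|,|y|)>\frac12$ and $y\in A$ imply $x\in A$. It is a fuzzy band if $z\in A$ whenever $D\subseteq A$ and $z=\sup D$ exists in $E$. It is uniformly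 fuzzy closed if $x\in A$ whenever there are $x_n\in A$ ($n\in\mathbb N$) and $w\in E^+$ such that for every $\varepsilon>0$ one has $\mu(|x-x_n|,\varepsilon w)>\frac12$ for all sufficiently large $n$. **Theorem 4.11.** Let $E$ be a fuzzy Riesz space, and consider the statements 1. $E$ has the fuzzy order continuity property; 2. every fuzzy lattice homomorphism from $E$ into a fuzzy Archimedean Riesz space is fuzzy order continuous; 3. every uniformly fuzzy closed fuzzy ideal of $E$ is a fuzzy band; 4. $E$ has the fuzzy $\sigma$-order continuity property and the fuzzy countable sup property. Then (1), (2) and (3) are equivalent, and (4) implies (1). If $E$ is fuzzy Archimedean, then (1), (2), (3) and (4) are all equivalent. -/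

import Mathlib

namespace FuzzyRiesz

universe u v

/-- A fuzzy ordered set: a set `E` with a fuzzy order `μ : E × E → [0,1]`. -/
class FuzzyOrderedSet (E : Type u) where
  μ : E → E → unitInterval
  μ_refl : ∀ x, μ x x = 1
  μ_antisymm : ∀ x y, 1 < (μ x y : ℝ) + (μ y x : ℝ) → x = y
  μ_trans : ∀ x z, (⨆ y, μ x y ⊓ μ y z) ≤ μ x z

/-- `x` lies below `y` in the fuzzy order: `μ(x, y) > 1/2`. -/
def Below {E : Type u} [FuzzyOrderedSet E] (x y : E) : Prop :=
  (1 / 2 : ℝ) < (FuzzyOrderedSet.μ x y : ℝ)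

section Bounds

variable {E : Type u} [FuzzyOrderedSet E]

open Classical in
/-- The fuzzy set `U(A)` of upper bounds of a crisp set `A`. -/
noncomputable def upper (A : Set E) (y : E) : unitInterval :=
  if ∃ x ∈ A, (FuzzyOrderedSet.μ x y : ℝ) ≤ 1 / 2 then 0
  else ⨅ x ∈ A, FuzzyOrderedSet.μ x y

open Classical in
/-- The fuzzy set `L(A)` of lower bounds of a crisp set `A`. -/
noncomputable def lower (A : Set E) (y : E) : unitInterval :=
  if ∃ x ∈ A, (FuzzyOrderedSet.μ y x : ℝ) ≤ 1 / 2 then 0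
  else ⨅ x ∈ A, FuzzyOrderedSet.μ y x

/-- `y ∈ U(A)`, that is, `U(A)(y) > 0`. -/
def IsUpper (A : Set E) (y : E) : Prop := 0 < upper A y

/-- `y ∈ L(A)`, that is, `L(A)(y) > 0`. -/
def IsLower (A : Set E) (y : E) : Prop := 0 < lower A y

/-- `z = sup A`. -/
def IsSup (A : Set E) (z : E) : Prop := IsUpper A z ∧ ∀ y, IsUpper A y → IsUpper {z} y

/-- `z = inf A`. -/
def IsInf (A : Set E) (z : E) : Prop := IsLower A z ∧ ∀ y, IsLower A y → IsLower {z} y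

theorem isUpper_iff (A : Set E) (y : E) : IsUpper A y ↔ ∀ x ∈ A, Below x y := by
  classical
  unfold IsUpper upper Below
  split_ifs with h
  · obtain ⟨x, hx, h⟩ := h
    exact ⟨fun h0 => absurd h0 (lt_irrefl _), fun h' => absurd (h' x hx) (not_lt.mpr h)⟩
  · push Not at h
    refine ⟨fun _ => h, fun _ => ?_⟩
    let c : unitInterval := ⟨1 / 2, by norm_num, by norm_num⟩
    have hc : (0 : unitInterval) < c := by
      rw [← Subtype.coe_lt_coe]; norm_num [c]
    exact lt_of_lt_of_le hc (le_iInf₂ fun x hx => Subtype.coe_le_coe.mp (h x hx).le)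

theorem isLower_iff (A : Set E) (y : E) : IsLower A y ↔ ∀ x ∈ A, Below y x := by
  classical
  unfold IsLower lower Below
  split_ifs with h
  · obtain ⟨x, hx, h⟩ := h
    exact ⟨fun h0 => absurd h0 (lt_irrefl _), fun h' => absurd (h' x hx) (not_lt.mpr h)⟩
  · push Not at h
    refine ⟨fun _ => h, fun _ => ?_⟩
    let c : unitInterval := ⟨1 / 2, by norm_num, by norm_num⟩
    have hc : (0 : unitInterval) < c := by
      rw [← Subtype.coe_lt_coe]; norm_num [c]
    exact lt_of_lt_of_le hc (le_iInf₂ fun x hx => Subtype.coe_le_coe.mp (h x hx).le)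

end Bounds

/-- A fuzzy ordered (real) linear space. -/
class FuzzyOrderedSpace (E : Type u) [AddCommGroup E] [Module ℝ E] extends
    FuzzyOrderedSet E where
  μ_add : ∀ x₁ x₂ : E, (1 / 2 : ℝ) < (μ x₁ x₂ : ℝ) → ∀ x, μ x₁ x₂ ≤ μ (x₁ + x) (x₂ + x)
  μ_smul : ∀ x₁ x₂ : E, (1 / 2 : ℝ) < (μ x₁ x₂ : ℝ) →
    ∀ a : ℝ, 0 < a → μ x₁ x₂ ≤ μ (a • x₁) (a • x₂)

/-- A fuzzy Riesz space: a fuzzy ordered linear space that is a fuzzy lattice, i.e. in which any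
two elements have a supremum and an infimum. -/
class FuzzyRieszSpace (E : Type u) [AddCommGroup E] [Module ℝ E] extends
    FuzzyOrderedSpace E where
  exists_sup : ∀ x y : E, ∃ z, IsSup {x, y} z
  exists_inf : ∀ x y : E, ∃ z, IsInf {x, y} z

section Riesz

variable {E : Type u} [AddCommGroup E] [Module ℝ E] [FuzzyRieszSpace E]

/-- `x ∨ y`, the supremum of `{x, y}` (unique, by antisymmetry). -/
noncomputable def join (x y : E) : E := (FuzzyRieszSpace.exists_sup x y).choose

theorem join_spec (x y : E) : IsSup {x, y} (join x y) :=
  (FuzzyRieszSpace.exists_sup x y).choose_spec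

/-- `|x| = x ∨ (-x)`. -/
noncomputable def fabs (x : E) : E := join x (-x)

/-- A fuzzy ideal: a fuzzy solid vector subspace. -/
def IsFuzzyIdeal (A : Submodule ℝ E) : Prop :=
  ∀ x y : E, Below (fabs x) (fabs y) → y ∈ A → x ∈ A

/-- A fuzzy band: a fuzzy ideal that contains the supremum of each of its subsets having one. -/
def IsFuzzyBand (A : Submodule ℝ E) : Prop :=
  IsFuzzyIdeal A ∧ ∀ (D : Set E) (z : E), D ⊆ A → IsSup D z → z ∈ A

/-- The sequence `x` converges `w`-uniformly in fuzzy order to `l`. -/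
def ConvergesUniformlyBy (w : E) (x : ℕ → E) (l : E) : Prop :=
  ∀ ε : ℝ, 0 < ε → ∃ N : ℕ, ∀ n > N, Below (fabs (l - x n)) (ε • w)

/-- The sequence `x` converges relatively uniformly in fuzzy order to `l`. -/
def ConvergesRelUniformly (x : ℕ → E) (l : E) : Prop :=
  ∃ w : E, Below 0 w ∧ ConvergesUniformlyBy w x l

/-- `A` is uniformly fuzzy closed: it contains all relatively uniform limits of its sequences. -/
def IsUniformlyFuzzyClosed (A : Submodule ℝ E) : Prop :=
  ∀ (x : ℕ → E) (l : E), (∀ n, x n ∈ A) → ConvergesRelUniformly x l → l ∈ A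

/-- `y_α ↓ 0`: the net decreases and has infimum `0`. -/
def DecreasesToZero {ι : Type v} [Preorder ι] (y : ι → E) : Prop :=
  (∀ a b, a ≤ b → Below (y b) (y a)) ∧ IsInf (Set.range y) 0

/-- The net `x` is fuzzy order convergent to `l`. -/
def FuzzyOrderConverges {ι : Type v} [Preorder ι] (x : ι → E) (l : E) : Prop :=
  ∃ y : ι → E, DecreasesToZero y ∧ ∀ a, Below (fabs (x a - l)) (y a)

end Riesz

/-- The fuzzy Riesz space `E` is fuzzy Archimedean: no `{λ x : λ > 0}` with `x` positive and
nonzero is bounded above. -/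
def IsFuzzyArchimedean (E : Type u) [AddCommGroup E] [Module ℝ E] [FuzzyRieszSpace E] : Prop :=
  ∀ x : E, Below 0 x → x ≠ 0 → ¬ ∃ y, IsUpper {z | ∃ a : ℝ, 0 < a ∧ z = a • x} y

section Operators

variable {E : Type u} [AddCommGroup E] [Module ℝ E] [FuzzyRieszSpace E]
variable {F : Type u} [AddCommGroup F] [Module ℝ F] [FuzzyRieszSpace F]

/-- A fuzzy positive (linear) operator. -/
def IsFuzzyPositive (T : E →ₗ[ℝ] F) : Prop := ∀ x, Below 0 x → Below 0 (T x)

/-- A fuzzy lattice (Riesz) homomorphism. -/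
def IsFuzzyLatticeHom (T : E →ₗ[ℝ] F) : Prop := ∀ x y, T (join x y) = join (T x) (T y)

/-- Fuzzy order continuity: order null nets are mapped to order null nets. -/
def IsFuzzyOrderContinuous (T : E →ₗ[ℝ] F) : Prop :=
  ∀ (ι : Type u) [Preorder ι] [IsDirected ι (· ≤ ·)] [Nonempty ι] (x : ι → E),
    FuzzyOrderConverges x 0 → FuzzyOrderConverges (fun a => T (x a)) 0

/-- Fuzzy `σ`-order continuity: order null sequences are mapped to order null sequences. -/
def IsFuzzySigmaOrderContinuous (T : E →ₗ[ℝ] F) : Prop :=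
  ∀ x : ℕ → E, FuzzyOrderConverges x 0 → FuzzyOrderConverges (fun n => T (x n)) 0

end Operators

section Properties

variable (E : Type u) [AddCommGroup E] [Module ℝ E] [FuzzyRieszSpace E]

/-- The fuzzy order continuity property. -/
def HasFuzzyOrderContinuityProperty : Prop :=
  ∀ (F : Type u) [AddCommGroup F] [Module ℝ F] [FuzzyRieszSpace F], IsFuzzyArchimedean F →
    ∀ T : E →ₗ[ℝ] F, IsFuzzyPositive T → IsFuzzyOrderContinuous T

/-- The fuzzy `σ`-order continuity property. -/
def HasFuzzySigmaOrderContinuityProperty : Prop :=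
  ∀ (F : Type u) [AddCommGroup F] [Module ℝ F] [FuzzyRieszSpace F], IsFuzzyArchimedean F →
    ∀ T : E →ₗ[ℝ] F, IsFuzzyPositive T → IsFuzzySigmaOrderContinuous T

/-- The fuzzy countable sup property. -/
def HasFuzzyCountableSupProperty : Prop :=
  ∀ (A : Set E) (z : E), IsSup A z → ∃ B ⊆ A, B.Countable ∧ IsSup B z

/-- Every fuzzy lattice homomorphism into a fuzzy Archimedean Riesz space is fuzzy order
continuous. -/
def LatticeHomsAreOrderContinuous : Prop :=
  ∀ (F : Type u) [AddCommGroup F] [Module ℝ F] [FuzzyRieszSpace F], IsFuzzyArchimedean F →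
    ∀ T : E →ₗ[ℝ] F, IsFuzzyLatticeHom T → IsFuzzyOrderContinuous T

/-- Every uniformly fuzzy closed fuzzy ideal is a fuzzy band. -/
def ClosedIdealsAreBands : Prop :=
  ∀ A : Submodule ℝ E, IsFuzzyIdeal A → IsUniformlyFuzzyClosed A → IsFuzzyBand A

end Properties

end FuzzyRiesz

/-!
The relation `Below x y`, that is `μ(x, y) > 1/2`, is an ordinary partial order, and it turns a
fuzzy Riesz space into an ordinary vector lattice; conversely every vector lattice order carries
the two-valued fuzzy order. So the theorem is one about vector lattices, and all of it is
proved with Mathlib's lattice notation for `Below`.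

* Lattice homomorphisms order continuous ⇒ uniformly closed ideals are bands. If `A` is a uniformly
  closed ideal, then `E ⧸ A` is an Archimedean vector lattice (`quotientRiesz`,
  `quotient_archimedean`) and the quotient map is a lattice homomorphism. If `z = sup D` with
  `D ⊆ A` directed, then `z - d ↓ 0`, while the image of `z - d` is constantly that of `z`; order
  continuity forces this image to vanish.

* Uniformly closed ideals are bands ⇒ positive operators are order continuous
  (`decreasesToZero_map`). Let `y_α ↓ 0`, `u = y_{α₀}` and `w_α = (y_α - ε u)⁺`. The `x` for which
  `T (|x| ⊓ w_α)` has infimum `0` form an ideal, which is uniformly closed as `F` is Archimedean.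
  It contains each `(ε u - y_α)⁺`, as this is disjoint from `w_α`, hence their supremum
  `ε u`, and so `u`. Since `y_α ≤ ε u + w_α`, every lower bound of `T y_α` is at most `ε T u`, for
  every `ε > 0`, and the Archimedean property finishes the argument.

* `σ`-order continuity and the countable sup property ⇒ order continuity: a net decreasing to `0`
  contains a decreasing sequence with infimum `0`.

* Uniformly closed ideals are bands, `E` Archimedean ⇒ countable sup property. For a set `S`, the
  `x` that are disjoint from everything disjoint from some countable part of `S` form a uniformly
  closed ideal, hence a band, hence one containing `sup S` (`exists_countable_disjoint`). Applied to the sets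
  `{(ε u - (z - a))⁺ : a ∈ A}`, where `z = sup A`, `u = z - a₀` and `ε = 1 / (n + 1)`, this yields
  countable subsets of `A` whose union has supremum `z`.
-/

namespace FuzzyRiesz

universe w

/-! ### The vector lattice underlying a fuzzy Riesz space -/

section Order

theorem Below.refl {E : Type u} [FuzzyOrderedSet E] (x : E) : Below x x := by
  unfold Below
  rw [FuzzyOrderedSet.μ_refl]
  norm_num

theorem Below.trans {E : Type u} [FuzzyOrderedSet E] {x y z : E} (h₁ : Below x y)
    (h₂ : Below y z) : Below x z := by
  have h : FuzzyOrderedSet.μ x y ⊓ FuzzyOrderedSet.μ y z ≤ FuzzyOrderedSet.μ x z :=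
    (le_iSup (fun y => FuzzyOrderedSet.μ x y ⊓ FuzzyOrderedSet.μ y z) y).trans
      (FuzzyOrderedSet.μ_trans x z)
  unfold Below at *
  rcases inf_le_iff.mp h with h | h
  · exact h₁.trans_le h
  · exact h₂.trans_le h

theorem Below.antisymm {E : Type u} [FuzzyOrderedSet E] {x y : E} (h₁ : Below x y)
    (h₂ : Below y x) : x = y := by
  apply FuzzyOrderedSet.μ_antisymm
  unfold Below at *
  linarith

variable {E : Type u} [AddCommGroup E] [Module ℝ E] [FuzzyRieszSpace E]

/-- The lattice order `Below` of a fuzzy Riesz space. -/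
noncomputable instance instLattice : Lattice E where
  le := Below
  le_refl := Below.refl
  le_trans _ _ _ := Below.trans
  le_antisymm _ _ := Below.antisymm
  sup := join
  inf x y := (FuzzyRieszSpace.exists_inf x y).choose
  le_sup_left x y := (isUpper_iff _ _).mp (join_spec x y).1 x (by simp)
  le_sup_right x y := (isUpper_iff _ _).mp (join_spec x y).1 y (by simp)
  sup_le x y z h₁ h₂ := (isUpper_iff _ _).mp
    ((join_spec x y).2 z ((isUpper_iff _ _).mpr (by simp [h₁, h₂]))) _ rfl
  inf_le_left x y :=
    (isLower_iff _ _).mp (FuzzyRieszSpace.exists_inf x y).choose_spec.1 x (by simp)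
  inf_le_right x y :=
    (isLower_iff _ _).mp (FuzzyRieszSpace.exists_inf x y).choose_spec.1 y (by simp)
  le_inf x y z h₁ h₂ := (isLower_iff _ _).mp
    ((FuzzyRieszSpace.exists_inf y z).choose_spec.2 x ((isLower_iff _ _).mpr
      (by simp [h₁, h₂]))) _ rfl

theorem below_iff {x y : E} : Below x y ↔ x ≤ y := Iff.rfl

theorem fabs_eq (x : E) : fabs x = |x| := rfl

theorem join_eq (x y : E) : join x y = x ⊔ y := rfl

theorem isUpper_iff_mem {A : Set E} {y : E} : IsUpper A y ↔ y ∈ upperBounds A :=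
  isUpper_iff A y

theorem isSup_iff {A : Set E} {z : E} : IsSup A z ↔ IsLUB A z := by
  simp [IsSup, IsLUB, IsLeast, lowerBounds, isUpper_iff_mem]

theorem isInf_iff {A : Set E} {z : E} : IsInf A z ↔ IsGLB A z := by
  have h {B : Set E} {y : E} : IsLower B y ↔ y ∈ lowerBounds B := isLower_iff B y
  simp [IsInf, IsGLB, IsGreatest, upperBounds, h]

instance instIsOrderedAddMonoid : IsOrderedAddMonoid E where
  add_le_add_left x y h z :=
    lt_of_lt_of_le (b := (FuzzyOrderedSet.μ x y : ℝ)) h (FuzzyOrderedSpace.μ_add x y h z)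

instance instPosSMulMono : PosSMulMono ℝ E where
  smul_le_smul_of_nonneg_left a ha x y h := by
    rcases ha.eq_or_lt with rfl | ha
    · simp
    · exact lt_of_lt_of_le (b := (FuzzyOrderedSet.μ x y : ℝ)) h
        (FuzzyOrderedSpace.μ_smul x y h a ha)

instance instSMulPosMono : SMulPosMono ℝ E where
  smul_le_smul_of_nonneg_right x hx a b h := by
    have := smul_nonneg (sub_nonneg.mpr h) hx
    rwa [sub_smul, sub_nonneg] at this

end Order

open Classical in
/-- The two-valued fuzzy order of a vector lattice order `r`; infima are obtained from suprema by
negation. -/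
noncomputable abbrev FuzzyRieszSpace.ofRel {E : Type u} [AddCommGroup E] [Module ℝ E]
    (r : E → E → Prop) (refl : ∀ x, r x x) (antisymm : ∀ x y, r x y → r y x → x = y)
    (trans : ∀ x y z, r x y → r y z → r x z)
    (add : ∀ x y, r x y → ∀ z, r (x + z) (y + z))
    (smul : ∀ x y, r x y → ∀ a : ℝ, 0 < a → r (a • x) (a • y))
    (sup : ∀ x y, ∃ z, r x z ∧ r y z ∧ ∀ t, r x t → r y t → r z t) : FuzzyRieszSpace E :=
  letI base : FuzzyOrderedSpace E :=
    { μ := fun x y => if r x y then 1 else 0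
      μ_refl := fun x => by simp [refl]
      μ_antisymm := fun x y h => by
        split_ifs at h with h₁ h₂
        · exact antisymm x y h₁ h₂
        all_goals norm_num at h
      μ_trans := fun x z => by
        refine iSup_le fun y => ?_
        by_cases h : r x y ∧ r y z
        · simp [trans x y z h.1 h.2, unitInterval.le_one']
        · by_cases h' : r x y
          · simp [show ¬ r y z from fun k => h ⟨h', k⟩]
          · simp [h']
      μ_add := fun x y h z => by
        split_ifs at h with h₁
        · simp [h₁, add x y h₁ z]
        · norm_num at h
      μ_smul := fun x y h a ha => by
        split_ifs at h with h₁
        · simp [h₁, smul x y h₁ a ha]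
        · norm_num at h }
  have hB (x y : E) : Below x y ↔ r x y := by
    change (1 / 2 : ℝ) < ((if r x y then 1 else 0 : unitInterval) : ℝ) ↔ _
    split_ifs with h <;> (simp [h]; try norm_num)
  have neg (x y : E) (h : r x y) : r (-y) (-x) := by
    have := add x y h (-x - y)
    rwa [show x + (-x - y) = -y by abel, show y + (-x - y) = -x by abel] at this
  { exists_sup := fun x y => by
      obtain ⟨z, h₁, h₂, h₃⟩ := sup x y
      refine ⟨z, ?_, fun t => ?_⟩
      · simp [isUpper_iff, hB, h₁, h₂]
      · simpa [isUpper_iff, hB] using h₃ t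
    exists_inf := fun x y => by
      obtain ⟨z, h₁, h₂, h₃⟩ := sup (-x) (-y)
      refine ⟨-z, ?_, fun t => ?_⟩
      · simp only [isLower_iff, hB]
        rintro t (rfl | rfl)
        · simpa using neg _ _ h₁
        · simpa using neg _ _ h₂
      · simp only [isLower_iff, hB]
        rintro h t rfl
        simpa using neg _ _ (h₃ (-t) (neg _ _ (h x (by simp))) (neg _ _ (h y (by simp)))) }

/-! ### Vector lattice inequalities, ideals and positive operators -/

section Lattice

variable {E : Type u} [AddCommGroup E] [Module ℝ E] [FuzzyRieszSpace E]

theorem add_inf_le_inf_add_inf {a b c : E} (ha : 0 ≤ a) (hb : 0 ≤ b) (hc : 0 ≤ c) :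
    (a + b) ⊓ c ≤ a ⊓ c + b ⊓ c := by
  rw [add_inf, inf_add, inf_add]
  refine le_inf (le_inf inf_le_left ?_) (le_inf ?_ ?_)
  · exact inf_le_right.trans (le_add_of_nonneg_right hb)
  · exact inf_le_right.trans (le_add_of_nonneg_left ha)
  · exact inf_le_right.trans (le_add_of_nonneg_left hc)

theorem posPart_sub_inf_posPart_sub (a b : E) : (a - b)⁺ ⊓ (b - a)⁺ = 0 := by
  rw [← neg_sub a b, posPart_neg, posPart_inf_negPart_eq_zero]

theorem inf_abs_le_of_abs_sub_le {x y c r : E} (hc : 0 ≤ c) (h : |x - y| ≤ r) :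
    |x| ⊓ c ≤ |y| ⊓ c + r := by
  have h₁ : |x| ≤ |y| + |x - y| := by simpa using abs_add_le y (x - y)
  calc |x| ⊓ c ≤ (|y| + |x - y|) ⊓ c := inf_le_inf_right c h₁
    _ ≤ |y| ⊓ c + |x - y| ⊓ c := add_inf_le_inf_add_inf (abs_nonneg _) (abs_nonneg _) hc
    _ ≤ |y| ⊓ c + r := by gcongr; exact inf_le_left.trans h

theorem smul_le_abs_smul_abs (c : ℝ) (x : E) : c • x ≤ |c| • |x| := by
  rcases le_total 0 c with h | h
  · rw [abs_of_nonneg h]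
    exact smul_le_smul_of_nonneg_left (le_abs_self x) h
  · rw [abs_of_nonpos h, ← neg_smul_neg]
    exact smul_le_smul_of_nonneg_left (neg_le_abs x) (neg_nonneg.mpr h)

theorem abs_smul_le (c : ℝ) (x : E) : |c • x| ≤ |c| • |x| :=
  abs_le'.mpr ⟨smul_le_abs_smul_abs c x, by simpa using smul_le_abs_smul_abs (-c) x⟩

/-- A solid set that is closed under addition is a subspace. -/
def solidSubmodule (S : Set E) (zero : (0 : E) ∈ S)
    (add : ∀ x ∈ S, ∀ y ∈ S, |x| + |y| ∈ S) (solid : ∀ x y, |x| ≤ |y| → y ∈ S → x ∈ S) :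
    Submodule ℝ E where
  carrier := S
  zero_mem' := zero
  add_mem' {x y} hx hy := solid _ _ (by
    rw [abs_of_nonneg (add_nonneg (abs_nonneg x) (abs_nonneg y))]
    exact abs_add_le x y) (add x hx y hy)
  smul_mem' c x hx := by
    have key (n : ℕ) : n • |x| ∈ S := by
      induction n with
      | zero => simpa using zero
      | succ n ih =>
        have := add _ ih _ hx
        rwa [abs_of_nonneg (nsmul_nonneg (abs_nonneg x) n), ← succ_nsmul] at this
    obtain ⟨n, hn⟩ := exists_nat_ge |c|
    refine solid _ _ ?_ (key n)
    rw [abs_of_nonneg (nsmul_nonneg (abs_nonneg x) n)]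
    refine (abs_smul_le c x).trans ?_
    rw [← Nat.cast_smul_eq_nsmul ℝ]
    exact smul_le_smul_of_nonneg_right hn (abs_nonneg x)

theorem IsFuzzyIdeal.mem_of_abs_le {A : Submodule ℝ E} (hA : IsFuzzyIdeal A) {x y : E}
    (h : |x| ≤ |y|) (hy : y ∈ A) : x ∈ A := hA x y h hy

theorem IsFuzzyIdeal.abs_mem {A : Submodule ℝ E} (hA : IsFuzzyIdeal A) {x : E} (hx : x ∈ A) :
    |x| ∈ A := hA.mem_of_abs_le (abs_abs x).le hx

theorem IsFuzzyIdeal.mem_of_nonneg_of_le {A : Submodule ℝ E} (hA : IsFuzzyIdeal A) {x y : E}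
    (hx : 0 ≤ x) (h : x ≤ y) (hy : y ∈ A) : x ∈ A :=
  hA.mem_of_abs_le (abs_le_abs_of_nonneg hx h) hy

theorem IsFuzzyArchimedean.nonpos (hE : IsFuzzyArchimedean E) {x v : E}
    (h : ∀ ε : ℝ, 0 < ε → x ≤ ε • v) (hv : 0 ≤ v) : x ≤ 0 := by
  rw [← posPart_eq_zero]
  by_contra hx
  refine hE x⁺ (posPart_nonneg x) hx ⟨v, isUpper_iff_mem.mpr ?_⟩
  rintro _ ⟨a, ha, rfl⟩
  have h₁ : x⁺ ≤ a⁻¹ • v :=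
    sup_le (h _ (inv_pos.mpr ha)) (smul_nonneg (inv_pos.mpr ha).le hv)
  simpa [smul_smul, ha.ne'] using smul_le_smul_of_nonneg_left h₁ ha.le

theorem decreasesToZero_iff {ι : Type w} [Preorder ι] {y : ι → E} :
    DecreasesToZero y ↔ Antitone y ∧ IsGLB (Set.range y) 0 := by
  rw [DecreasesToZero, isInf_iff]
  rfl

variable {F : Type u} [AddCommGroup F] [Module ℝ F] [FuzzyRieszSpace F]

theorem IsFuzzyPositive.monotone {T : E →ₗ[ℝ] F} (hT : IsFuzzyPositive T) : Monotone T :=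
  fun x y h => by
    have h₁ : 0 ≤ T (y - x) := hT (y - x) (sub_nonneg.mpr h)
    rwa [map_sub, sub_nonneg] at h₁

theorem IsFuzzyPositive.abs_map_le {T : E →ₗ[ℝ] F} (hT : IsFuzzyPositive T) (x : E) :
    |T x| ≤ T |x| :=
  abs_le'.mpr ⟨hT.monotone (le_abs_self x), by simpa using hT.monotone (neg_le_abs x)⟩

theorem IsFuzzyLatticeHom.isFuzzyPositive {T : E →ₗ[ℝ] F} (hT : IsFuzzyLatticeHom T) :
    IsFuzzyPositive T := by
  intro x (hx : 0 ≤ x)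
  have h := hT x 0
  rw [join_eq, join_eq, sup_eq_left.mpr hx, map_zero] at h
  exact sup_eq_left.mp h.symm

/-- A positive operator that preserves decrease to `0` along a given index set preserves order null
nets along it. -/
theorem IsFuzzyPositive.fuzzyOrderConverges {T : E →ₗ[ℝ] F} (hT : IsFuzzyPositive T)
    {ι : Type w} [Preorder ι]
    (h : ∀ y : ι → E, DecreasesToZero y → DecreasesToZero fun a => T (y a)) {x : ι → E}
    (hx : FuzzyOrderConverges x 0) : FuzzyOrderConverges (fun a => T (x a)) 0 := by
  obtain ⟨y, hy, hxy⟩ := hx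
  refine ⟨_, h y hy, fun a => ?_⟩
  rw [sub_zero]
  refine (hT.abs_map_le (x a)).trans (hT.monotone ?_)
  simpa [below_iff, fabs_eq] using hxy a

theorem DecreasesToZero.fuzzyOrderConverges {ι : Type w} [Preorder ι] {y : ι → E}
    (hy : DecreasesToZero y) : FuzzyOrderConverges y 0 := by
  refine ⟨y, hy, fun a => ?_⟩
  rw [sub_zero, below_iff, fabs_eq]
  exact (abs_of_nonneg ((decreasesToZero_iff.mp hy).2.1 ⟨a, rfl⟩)).le

theorem FuzzyOrderConverges.nonpos_of_le {ι : Type w} [Preorder ι] {y : ι → E}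
    (hy : FuzzyOrderConverges y 0) {h : E} (hh : ∀ a, h ≤ y a) : h ≤ 0 := by
  obtain ⟨z, hz, hyz⟩ := hy
  refine (decreasesToZero_iff.mp hz).2.2 ?_
  rintro _ ⟨a, rfl⟩
  have h₁ : |y a| ≤ z a := by simpa [below_iff, fabs_eq] using hyz a
  exact (hh a).trans ((le_abs_self _).trans h₁)

end Lattice

/-! ### Positive operators when uniformly closed ideals are bands -/

section ClosedIdeals

variable {E : Type u} [AddCommGroup E] [Module ℝ E] [FuzzyRieszSpace E]
variable {F : Type u} [AddCommGroup F] [Module ℝ F] [FuzzyRieszSpace F]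

/-- For a decreasing net `w` of positive elements and a positive operator `T`, the ideal of all `x`
with `inf_α T (|x| ⊓ w_α) = 0`. -/
def vanishingIdeal {T : E →ₗ[ℝ] F} (hT : IsFuzzyPositive T) {ι : Type w} [Preorder ι]
    [IsDirected ι (· ≤ ·)] [Nonempty ι] {w : ι → E} (hw : Antitone w) (hw₀ : ∀ a, 0 ≤ w a) :
    Submodule ℝ E :=
  solidSubmodule {x | ∀ h : F, (∀ a, h ≤ T (|x| ⊓ w a)) → h ≤ 0}
    (fun h hh => by
      obtain ⟨a⟩ := ‹Nonempty ι›
      simpa [inf_eq_left.mpr (hw₀ a)] using hh a)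
    (fun x hx y hy h hh => by
      -- Split the two infima: at a common later index, `h ≤ T (|x| ⊓ w a) + T (|y| ⊓ w b)`.
      refine hx h fun a => sub_nonpos.mp (hy _ fun b => ?_)
      obtain ⟨c, hac, hbc⟩ := exists_ge_ge a b
      rw [sub_le_iff_le_add, ← map_add]
      refine (hh c).trans (hT.monotone ?_)
      rw [abs_of_nonneg (add_nonneg (abs_nonneg x) (abs_nonneg y)), add_comm]
      refine (add_inf_le_inf_add_inf (abs_nonneg y) (abs_nonneg x) (hw₀ c)).trans ?_
      exact add_le_add (inf_le_inf_left _ (hw hbc)) (inf_le_inf_left _ (hw hac)))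
    (fun x y hxy hy h hh => hy h fun a =>
      (hh a).trans (hT.monotone (inf_le_inf_right _ hxy)))

theorem mem_vanishingIdeal {T : E →ₗ[ℝ] F} (hT : IsFuzzyPositive T) {ι : Type w} [Preorder ι]
    [IsDirected ι (· ≤ ·)] [Nonempty ι] {w : ι → E} (hw : Antitone w) (hw₀ : ∀ a, 0 ≤ w a)
    {x : E} : x ∈ vanishingIdeal hT hw hw₀ ↔ ∀ h : F, (∀ a, h ≤ T (|x| ⊓ w a)) → h ≤ 0 :=
  Iff.rfl

theorem vanishingIdeal_isFuzzyIdeal {T : E →ₗ[ℝ] F} (hT : IsFuzzyPositive T) {ι : Type w}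
    [Preorder ι] [IsDirected ι (· ≤ ·)] [Nonempty ι] {w : ι → E} (hw : Antitone w)
    (hw₀ : ∀ a, 0 ≤ w a) : IsFuzzyIdeal (vanishingIdeal hT hw hw₀) :=
  fun _ _ hxy hy h hh => hy h fun a => (hh a).trans (hT.monotone (inf_le_inf_right _ hxy))

theorem vanishingIdeal_isUniformlyFuzzyClosed (hF : IsFuzzyArchimedean F) {T : E →ₗ[ℝ] F}
    (hT : IsFuzzyPositive T) {ι : Type w} [Preorder ι] [IsDirected ι (· ≤ ·)] [Nonempty ι]
    {w : ι → E} (hw : Antitone w) (hw₀ : ∀ a, 0 ≤ w a) :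
    IsUniformlyFuzzyClosed (vanishingIdeal hT hw hw₀) := by
  rintro x l hx ⟨v, hv, hconv⟩ h hh
  refine hF.nonpos (fun ε hε => ?_) (hT v hv)
  obtain ⟨N, hN⟩ := hconv ε hε
  rw [← sub_nonpos]
  refine hx (N + 1) _ fun a => ?_
  rw [sub_le_iff_le_add, ← map_smul, ← map_add]
  exact (hh a).trans (hT.monotone
    (inf_abs_le_of_abs_sub_le (hw₀ a) (hN (N + 1) (Nat.lt_succ_self N))))

theorem isLUB_posPart_smul_sub {ι : Type w} {y : ι → E} (hy : IsGLB (Set.range y) 0) {u : E}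
    (hu : 0 ≤ u) : IsLUB (Set.range fun a => (u - y a)⁺) u := by
  constructor
  · rintro _ ⟨a, rfl⟩
    exact sup_le (sub_le_self _ (hy.1 ⟨a, rfl⟩)) hu
  · intro b hb
    rw [← sub_nonpos]
    refine hy.2 ?_
    rintro _ ⟨a, rfl⟩
    rw [sub_le_comm]
    exact (le_posPart _).trans (hb ⟨a, rfl⟩)

/-- If uniformly closed ideals are bands, positive operators into Archimedean spaces preserve
decrease to `0`. -/
theorem ClosedIdealsAreBands.decreasesToZero_map (hE : ClosedIdealsAreBands E)
    (hF : IsFuzzyArchimedean F) {T : E →ₗ[ℝ] F} (hT : IsFuzzyPositive T) {ι : Type w}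
    [Preorder ι] [IsDirected ι (· ≤ ·)] [Nonempty ι] {y : ι → E} (hy : DecreasesToZero y) :
    DecreasesToZero fun a => T (y a) := by
  rw [decreasesToZero_iff] at hy ⊢
  obtain ⟨hanti, hinf⟩ := hy
  have hy₀ (a : ι) : 0 ≤ y a := hinf.1 ⟨a, rfl⟩
  refine ⟨fun a b hab => hT.monotone (hanti hab), ?_, ?_⟩
  · rintro _ ⟨a, rfl⟩
    exact hT _ (hy₀ a)
  intro h hh
  let i := Classical.arbitrary ι
  refine hF.nonpos (fun ε hε => ?_) (hT _ (hy₀ i))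
  have hw : Antitone fun a => (y a - ε • y i)⁺ := fun a b hab =>
    posPart_mono (sub_le_sub_right (hanti hab) _)
  have hw₀ (a : ι) : 0 ≤ (y a - ε • y i)⁺ := posPart_nonneg _
  have hband := hE _ (vanishingIdeal_isFuzzyIdeal hT hw hw₀)
    (vanishingIdeal_isUniformlyFuzzyClosed hF hT hw hw₀)
  have hmem : ε • y i ∈ vanishingIdeal hT hw hw₀ := by
    refine hband.2 _ _ ?_ (isSup_iff.mpr
      (isLUB_posPart_smul_sub hinf (smul_nonneg hε.le (hy₀ i))))
    rintro _ ⟨a, rfl⟩ k hk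
    have := hk a
    rwa [abs_of_nonneg (posPart_nonneg _), posPart_sub_inf_posPart_sub, map_zero] at this
  rw [Submodule.smul_mem_iff _ hε.ne', mem_vanishingIdeal] at hmem
  rw [← sub_nonpos]
  refine hmem _ fun a => ?_
  obtain ⟨c, hac, hic⟩ := exists_ge_ge a i
  rw [sub_le_iff_le_add, ← map_smul, ← map_add]
  refine (hh ⟨c, rfl⟩).trans (hT.monotone ?_)
  have h₁ : (y c - ε • y i)⁺ ≤ |y i| ⊓ (y a - ε • y i)⁺ := by
    refine le_inf ?_ (hw hac)
    rw [abs_of_nonneg (hy₀ i)]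
    exact sup_le ((sub_le_self _ (smul_nonneg hε.le (hy₀ i))).trans (hanti hic)) (hy₀ i)
  exact (sub_le_iff_le_add.mp (le_posPart _)).trans (add_le_add_left h₁ _)

end ClosedIdeals

/-! ### Quotients by uniformly closed ideals -/

section Quotient

variable {E : Type u} [AddCommGroup E] [Module ℝ E] [FuzzyRieszSpace E] {A : Submodule ℝ E}

/-- The order of `E ⧸ A`: two classes are related if they have related representatives. -/
def QuotientLE (A : Submodule ℝ E) (p q : E ⧸ A) : Prop :=
  ∃ x y : E, A.mkQ x = p ∧ A.mkQ y = q ∧ x ≤ y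

theorem quotientLE_mkQ_iff {x y : E} :
    QuotientLE A (A.mkQ x) (A.mkQ y) ↔ ∃ a ∈ A, x ≤ y + a := by
  constructor
  · rintro ⟨x', y', hx, hy, h⟩
    rw [Submodule.mkQ_apply, Submodule.mkQ_apply, Submodule.Quotient.eq] at hx hy
    refine ⟨(y' - y) - (x' - x), A.sub_mem hy hx, ?_⟩
    have := add_le_add_left h (x - x')
    convert! this using 1 <;> abel
  · rintro ⟨a, ha, h⟩
    exact ⟨x, y + a, rfl, by simpa using ha, h⟩

theorem quotientLE_mkQ_iff_posPart_mem (hA : IsFuzzyIdeal A) {x y : E} :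
    QuotientLE A (A.mkQ x) (A.mkQ y) ↔ (x - y)⁺ ∈ A := by
  rw [quotientLE_mkQ_iff]
  constructor
  · rintro ⟨a, ha, h⟩
    exact hA.mem_of_nonneg_of_le (posPart_nonneg _)
      (sup_le ((sub_le_iff_le_add'.mpr h).trans (le_abs_self a)) (abs_nonneg a)) (hA.abs_mem ha)
  · exact fun h => ⟨_, h, sub_le_iff_le_add'.mp (le_posPart _)⟩

theorem quotientLE_sup_mkQ (hA : IsFuzzyIdeal A) {x y z : E}
    (hx : QuotientLE A (A.mkQ x) (A.mkQ z)) (hy : QuotientLE A (A.mkQ y) (A.mkQ z)) :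
    QuotientLE A (A.mkQ (x ⊔ y)) (A.mkQ z) := by
  rw [quotientLE_mkQ_iff] at hx hy ⊢
  obtain ⟨a, ha, hx⟩ := hx
  obtain ⟨b, hb, hy⟩ := hy
  refine ⟨|a| + |b|, A.add_mem (hA.abs_mem ha) (hA.abs_mem hb), sup_le ?_ ?_⟩
  · exact hx.trans (add_le_add_right
      ((le_abs_self a).trans (le_add_of_nonneg_right (abs_nonneg b))) z)
  · exact hy.trans (add_le_add_right
      ((le_abs_self b).trans (le_add_of_nonneg_left (abs_nonneg a))) z)

/-- The quotient of a fuzzy Riesz space by an ideal, with the two-valued fuzzy order of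
`QuotientLE`. -/
noncomputable abbrev quotientRiesz (hA : IsFuzzyIdeal A) : FuzzyRieszSpace (E ⧸ A) :=
  FuzzyRieszSpace.ofRel (QuotientLE A)
    (fun p => by
      obtain ⟨x, rfl⟩ := A.mkQ_surjective p
      exact ⟨x, x, rfl, rfl, le_rfl⟩)
    (fun p q h₁ h₂ => by
      obtain ⟨x, rfl⟩ := A.mkQ_surjective p
      obtain ⟨y, rfl⟩ := A.mkQ_surjective q
      rw [quotientLE_mkQ_iff_posPart_mem hA] at h₁ h₂
      rw [Submodule.mkQ_apply, Submodule.mkQ_apply, Submodule.Quotient.eq,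
        ← posPart_sub_negPart (x - y), ← posPart_neg, neg_sub]
      exact A.sub_mem h₁ h₂)
    (fun p q r h₁ h₂ => by
      obtain ⟨x, rfl⟩ := A.mkQ_surjective p
      obtain ⟨y, rfl⟩ := A.mkQ_surjective q
      obtain ⟨z, rfl⟩ := A.mkQ_surjective r
      rw [quotientLE_mkQ_iff] at h₁ h₂ ⊢
      obtain ⟨a, ha, h₁⟩ := h₁
      obtain ⟨b, hb, h₂⟩ := h₂
      refine ⟨b + a, A.add_mem hb ha, h₁.trans ?_⟩
      rw [← add_assoc]
      exact add_le_add_left h₂ a)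
    (fun p q h r => by
      obtain ⟨x, y, rfl, rfl, h⟩ := h
      obtain ⟨z, rfl⟩ := A.mkQ_surjective r
      exact ⟨x + z, y + z, map_add _ _ _, map_add _ _ _, add_le_add_left h z⟩)
    (fun p q h a ha => by
      obtain ⟨x, y, rfl, rfl, h⟩ := h
      exact ⟨a • x, a • y, map_smul _ _ _, map_smul _ _ _, smul_le_smul_of_nonneg_left h ha.le⟩)
    (fun p q => by
      obtain ⟨x, rfl⟩ := A.mkQ_surjective p
      obtain ⟨y, rfl⟩ := A.mkQ_surjective q
      refine ⟨A.mkQ (x ⊔ y), ⟨x, _, rfl, rfl, le_sup_left⟩, ⟨y, _, rfl, rfl, le_sup_right⟩,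
        fun t h₁ h₂ => ?_⟩
      obtain ⟨z, rfl⟩ := A.mkQ_surjective t
      exact quotientLE_sup_mkQ hA h₁ h₂)

theorem quotient_below_iff (hA : IsFuzzyIdeal A) {p q : E ⧸ A} :
    letI := quotientRiesz hA
    p ≤ q ↔ QuotientLE A p q := by
  classical
  change (1 / 2 : ℝ) < ((if QuotientLE A p q then 1 else 0 : unitInterval) : ℝ) ↔ _
  split_ifs with h <;> (simp [h]; try norm_num)

theorem quotient_isFuzzyLatticeHom (hA : IsFuzzyIdeal A) :
    letI := quotientRiesz hA
    IsFuzzyLatticeHom A.mkQ := by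
  let := quotientRiesz hA
  intro x y
  rw [join_eq, join_eq]
  refine le_antisymm ((quotient_below_iff hA).mpr ?_) (sup_le ?_ ?_)
  · obtain ⟨z, hz⟩ := A.mkQ_surjective (A.mkQ x ⊔ A.mkQ y)
    rw [← hz]
    refine quotientLE_sup_mkQ hA ?_ ?_ <;> rw [hz, ← quotient_below_iff hA]
    · exact le_sup_left
    · exact le_sup_right
  · exact (quotient_below_iff hA).mpr ⟨x, _, rfl, rfl, le_sup_left⟩
  · exact (quotient_below_iff hA).mpr ⟨y, _, rfl, rfl, le_sup_right⟩

/-- The quotient by a uniformly closed ideal is Archimedean: if all multiples of the class of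
`x ≥ 0` lie below the class of `y ≥ 0`, then `(x - ε y)⁺` belongs to the ideal for each `ε > 0`, and
these elements converge `y`-uniformly to `x`. -/
theorem quotient_archimedean (hA : IsFuzzyIdeal A) (hc : IsUniformlyFuzzyClosed A) :
    letI := quotientRiesz hA
    IsFuzzyArchimedean (E ⧸ A) := by
  let := quotientRiesz hA
  rintro p (hp : 0 ≤ p) hp₀ ⟨q, hq⟩
  obtain ⟨x₀, x, hx₀, rfl, hx⟩ := (quotient_below_iff hA).mp hp
  rw [Submodule.mkQ_apply, Submodule.Quotient.mk_eq_zero] at hx₀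
  obtain ⟨y, rfl⟩ := A.mkQ_surjective q
  apply hp₀
  rw [Submodule.mkQ_apply, Submodule.Quotient.mk_eq_zero]
  rw [isUpper_iff_mem] at hq
  -- `x` is positive modulo `A`, so it suffices to treat its positive part.
  have hneg : x⁻ ∈ A := by
    refine hA.mem_of_nonneg_of_le (negPart_nonneg x) ?_ (hA.abs_mem hx₀)
    exact sup_le ((neg_le_neg hx).trans (neg_le_abs x₀)) (abs_nonneg x₀)
  have hmem (ε : ℝ) (hε : 0 < ε) : (x⁺ - ε • |y|)⁺ ∈ A := by
    have h₁ : A.mkQ (ε⁻¹ • x) ≤ A.mkQ y := hq ⟨ε⁻¹, inv_pos.mpr hε, map_smul _ _ _⟩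
    rw [quotient_below_iff hA, quotientLE_mkQ_iff] at h₁
    obtain ⟨a, ha, h₁⟩ := h₁
    have h₂ : x ≤ ε • y + ε • a := by
      simpa [smul_smul, hε.ne'] using smul_le_smul_of_nonneg_left h₁ hε.le
    refine hA.mem_of_nonneg_of_le (posPart_nonneg _) ?_
      (A.add_mem (A.smul_mem ε (hA.abs_mem ha)) hneg)
    have hεa : 0 ≤ ε • |a| := smul_nonneg hε.le (abs_nonneg a)
    refine sup_le ?_ (add_nonneg hεa (negPart_nonneg x))
    rw [sub_le_iff_le_add]
    have h₃ : x⁺ = x + x⁻ := by rw [← sub_eq_iff_eq_add, posPart_sub_negPart]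
    rw [h₃]
    calc x + x⁻ ≤ (ε • |y| + ε • |a|) + x⁻ := by
          gcongr
          exact h₂.trans (add_le_add (smul_le_smul_of_nonneg_left (le_abs_self y) hε.le)
            (smul_le_smul_of_nonneg_left (le_abs_self a) hε.le))
      _ = ε • |a| + x⁻ + ε • |y| := by abel
  have hpos : x⁺ ∈ A := by
    refine hc (fun n => (x⁺ - (1 / ((n : ℝ) + 1)) • |y|)⁺) _
      (fun n => hmem _ (by positivity)) ⟨|y|, abs_nonneg y, fun ε hε => ?_⟩
    obtain ⟨N, hN⟩ := exists_nat_one_div_lt hε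
    refine ⟨N, fun n hn => ?_⟩
    change |x⁺ - (x⁺ - (1 / ((n : ℝ) + 1)) • |y|)⁺| ≤ ε • |y|
    have hle : 1 / ((n : ℝ) + 1) ≤ ε :=
      (one_div_le_one_div_of_le (by positivity) (by gcongr)).trans hN.le
    have hδ : 0 ≤ (1 / ((n : ℝ) + 1)) • |y| := smul_nonneg (by positivity) (abs_nonneg y)
    refine le_trans ?_ (smul_le_smul_of_nonneg_right hle (abs_nonneg y))
    have hsub : (x⁺ - (1 / ((n : ℝ) + 1)) • |y|)⁺ ≤ x⁺ :=
      sup_le (sub_le_self _ hδ) (posPart_nonneg x)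
    rw [abs_of_nonneg (sub_nonneg.mpr hsub), sub_le_comm]
    exact le_posPart _
  rw [← posPart_sub_negPart x]
  exact A.sub_mem hpos hneg

theorem LatticeHomsAreOrderContinuous.closedIdealsAreBands
    (hE : LatticeHomsAreOrderContinuous E) : ClosedIdealsAreBands E := by
  intro A hA hc
  refine ⟨hA, fun D z hDA hz => ?_⟩
  rw [isSup_iff] at hz
  rcases D.eq_empty_or_nonempty with rfl | hD
  · -- A supremum of `∅` is a least element, which forces `z = 0`.
    have h₁ (y : E) : z ≤ y := hz.2 (by simp)
    have h₂ : 0 ≤ z := by simpa using h₁ (z + z)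
    rw [le_antisymm (h₁ 0) h₂]
    exact A.zero_mem
  let := quotientRiesz hA
  have hclosed : SupClosed (A : Set E) := fun a ha b hb => by
    refine hA.mem_of_abs_le ?_ (A.add_mem (hA.abs_mem ha) (hA.abs_mem hb))
    rw [abs_of_nonneg (add_nonneg (abs_nonneg a) (abs_nonneg b)), abs_le', neg_sup]
    refine ⟨sup_le ?_ ?_, inf_le_left.trans ?_⟩
    · exact (le_abs_self a).trans (le_add_of_nonneg_right (abs_nonneg b))
    · exact (le_abs_self b).trans (le_add_of_nonneg_left (abs_nonneg a))
    · exact (neg_le_abs a).trans (le_add_of_nonneg_right (abs_nonneg b))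
  have hsub : supClosure D ⊆ A := supClosure_min hDA hclosed
  rw [← isLUB_supClosure] at hz
  have : Nonempty (supClosure D) := (hD.mono subset_supClosure).to_subtype
  have : IsDirected (supClosure D) (· ≤ ·) :=
    ⟨fun a b => ⟨⟨a ⊔ b, supClosed_supClosure a.2 b.2⟩, le_sup_left (a := (a : E)),
      le_sup_right (a := (a : E))⟩⟩
  have hdec : DecreasesToZero fun d : supClosure D => z - (d : E) := by
    refine decreasesToZero_iff.mpr ⟨fun a b hab => sub_le_sub_left (show (a : E) ≤ b from hab) z, ?_, ?_⟩
    · rintro _ ⟨d, rfl⟩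
      exact sub_nonneg.mpr (hz.1 d.2)
    · intro b hb
      have : z ≤ z - b := hz.2 fun d hd => le_sub_comm.mp (hb ⟨⟨d, hd⟩, rfl⟩)
      simpa using this
  have hlim := hE _ (quotient_archimedean hA hc) _ (quotient_isFuzzyLatticeHom hA) _ _
    hdec.fuzzyOrderConverges
  obtain ⟨y, hy, hzy⟩ := hlim
  have hle : |A.mkQ z| ≤ 0 := by
    refine (decreasesToZero_iff.mp hy).2.2 ?_
    rintro _ ⟨d, rfl⟩
    have h₁ : A.mkQ (d : E) = 0 := by
      rw [Submodule.mkQ_apply, Submodule.Quotient.mk_eq_zero]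
      exact hsub d.2
    have h₂ : |A.mkQ (z - (d : E)) - 0| ≤ y d := hzy d
    rwa [sub_zero, map_sub, h₁, sub_zero] at h₂
  have hzero : A.mkQ z = 0 :=
    le_antisymm ((le_abs_self _).trans hle) (neg_nonpos.mp ((neg_le_abs _).trans hle))
  rwa [Submodule.mkQ_apply, Submodule.Quotient.mk_eq_zero] at hzero

end Quotient

/-! ### The countable sup property -/

section Countable

variable {E : Type u} [AddCommGroup E] [Module ℝ E] [FuzzyRieszSpace E]

/-- The ideal of all `x` that are disjoint from everything disjoint from some countable part
of `S`. -/
def countableDisjointIdeal (S : Set E) : Submodule ℝ E :=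
  solidSubmodule {x | ∃ C ⊆ S, C.Countable ∧
      ∀ g : E, 0 ≤ g → (∀ c ∈ C, |c| ⊓ g = 0) → |x| ⊓ g = 0}
    ⟨∅, Set.empty_subset S, Set.countable_empty, fun g hg _ => by simpa using hg⟩
    (by
      rintro x ⟨C, hC, hCc, hx⟩ y ⟨D, hD, hDc, hy⟩
      refine ⟨C ∪ D, Set.union_subset hC hD, hCc.union hDc, fun g hg h => ?_⟩
      have h₁ := hx g hg fun c hc => h c (Or.inl hc)
      have h₂ := hy g hg fun c hc => h c (Or.inr hc)
      have h₃ := add_inf_le_inf_add_inf (abs_nonneg x) (abs_nonneg y) hg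
      rw [h₁, h₂, add_zero] at h₃
      exact le_antisymm
        (by rwa [abs_of_nonneg (add_nonneg (abs_nonneg x) (abs_nonneg y))])
        (le_inf (abs_nonneg _) hg))
    (by
      rintro x y hxy ⟨C, hC, hCc, hy⟩
      exact ⟨C, hC, hCc, fun g hg h => le_antisymm
        ((inf_le_inf_right g hxy).trans (hy g hg h).le) (le_inf (abs_nonneg _) hg)⟩)

theorem countableDisjointIdeal_isFuzzyIdeal (S : Set E) :
    IsFuzzyIdeal (countableDisjointIdeal S) := by
  rintro x y hxy ⟨C, hC, hCc, hy⟩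
  exact ⟨C, hC, hCc, fun g hg h => le_antisymm
    ((inf_le_inf_right g hxy).trans (hy g hg h).le) (le_inf (abs_nonneg _) hg)⟩

theorem countableDisjointIdeal_isUniformlyFuzzyClosed (hE : IsFuzzyArchimedean E) (S : Set E) :
    IsUniformlyFuzzyClosed (countableDisjointIdeal S) := by
  rintro x l hx ⟨v, hv, hconv⟩
  choose C hC hCc hCx using hx
  refine ⟨⋃ n, C n, Set.iUnion_subset hC, Set.countable_iUnion hCc, fun g hg h => ?_⟩
  refine le_antisymm (hE.nonpos (fun ε hε => ?_) hv) (le_inf (abs_nonneg _) hg)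
  obtain ⟨N, hN⟩ := hconv ε hε
  have h₁ := inf_abs_le_of_abs_sub_le hg (hN (N + 1) (Nat.lt_succ_self N))
  rwa [hCx (N + 1) g hg fun c hc => h c (Set.mem_iUnion_of_mem _ hc), zero_add] at h₁

theorem ClosedIdealsAreBands.exists_countable_disjoint (hE : ClosedIdealsAreBands E)
    (hArch : IsFuzzyArchimedean E) {S : Set E} {v : E} (hv : IsLUB S v) :
    ∃ C ⊆ S, C.Countable ∧ ∀ g : E, 0 ≤ g → (∀ c ∈ C, |c| ⊓ g = 0) → |v| ⊓ g = 0 := by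
  have hband := hE _ (countableDisjointIdeal_isFuzzyIdeal S)
    (countableDisjointIdeal_isUniformlyFuzzyClosed hArch S)
  refine hband.2 S v (fun x hx => ?_) (isSup_iff.mpr hv)
  exact ⟨{x}, by simpa using hx, Set.countable_singleton x, fun g _ h => h x rfl⟩

theorem ClosedIdealsAreBands.hasFuzzyCountableSupProperty (hE : ClosedIdealsAreBands E)
    (hArch : IsFuzzyArchimedean E) : HasFuzzyCountableSupProperty E := by
  intro A z hz
  rcases A.eq_empty_or_nonempty with rfl | ⟨a₀, ha₀⟩
  · exact ⟨∅, subset_rfl, Set.countable_empty, hz⟩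
  rw [isSup_iff] at hz
  set u := z - a₀
  have hu₀ : 0 ≤ u := sub_nonneg.mpr (hz.1 ha₀)
  have hglb : IsGLB (Set.range fun a : A => z - (a : E)) 0 := by
    constructor
    · rintro _ ⟨a, rfl⟩
      exact sub_nonneg.mpr (hz.1 a.2)
    · intro b hb
      have : z ≤ z - b := hz.2 fun a ha => le_sub_comm.mp (hb ⟨⟨a, ha⟩, rfl⟩)
      simpa using this
  have key (n : ℕ) : ∃ C : Set A, C.Countable ∧ ∀ g : E, 0 ≤ g →
      (∀ a ∈ C, ((1 / ((n : ℝ) + 1)) • u - (z - (a : E)))⁺ ⊓ g = 0) →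
      ((1 / ((n : ℝ) + 1)) • u) ⊓ g = 0 := by
    have hεu : 0 ≤ (1 / ((n : ℝ) + 1)) • u := smul_nonneg (by positivity) hu₀
    obtain ⟨C, hC, hCc, h⟩ := hE.exists_countable_disjoint hArch
      (isLUB_posPart_smul_sub hglb hεu)
    have : Countable C := hCc.to_subtype
    choose k hk using fun c : C => hC c.2
    refine ⟨Set.range k, Set.countable_range k, fun g hg hdisj => ?_⟩
    have h₁ := h g hg fun c hc => by
      have h₂ := hdisj (k ⟨c, hc⟩) ⟨_, rfl⟩
      have h₃ : ((1 / ((n : ℝ) + 1)) • u - (z - (k ⟨c, hc⟩ : E)))⁺ = c := hk ⟨c, hc⟩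
      rwa [← h₃, abs_of_nonneg (posPart_nonneg _)]
    rwa [abs_of_nonneg hεu] at h₁
  choose C hCc hC using key
  refine ⟨{a₀} ∪ ⋃ n, (↑) '' C n, ?_, ?_, ?_⟩
  · refine Set.union_subset (by simpa using ha₀) (Set.iUnion_subset fun n => ?_)
    rintro _ ⟨a, _, rfl⟩
    exact a.2
  · exact (Set.countable_singleton _).union (Set.countable_iUnion fun n => (hCc n).image _)
  rw [isSup_iff]
  refine ⟨?_, fun y hy => ?_⟩
  · rintro a (rfl | ha)
    · exact hz.1 ha₀
    · obtain ⟨n, a, _, rfl⟩ := Set.mem_iUnion.mp ha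
      exact hz.1 a.2
  rw [← sub_nonpos]
  refine hArch.nonpos (fun ε hε => ?_) hu₀
  obtain ⟨n, hn⟩ := exists_nat_one_div_lt hε
  have hδ : (0 : ℝ) < 1 / ((n : ℝ) + 1) := by positivity
  have hδ₁ : 1 / ((n : ℝ) + 1) ≤ 1 := by
    rw [div_le_one (by positivity)]
    linarith [n.cast_nonneg (α := ℝ)]
  have hC' := hC n
  generalize 1 / ((n : ℝ) + 1) = δ at *
  refine le_trans ?_ (smul_le_smul_of_nonneg_right hn.le hu₀)
  have hδu : 0 ≤ δ • u := smul_nonneg hδ.le hu₀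
  rw [← sub_nonpos, ← posPart_eq_zero]
  set g := (z - y - δ • u)⁺
  have hg₀ : 0 ≤ g := posPart_nonneg _
  have hgu : g ≤ u := by
    refine sup_le ((sub_le_self _ hδu).trans ?_) hu₀
    exact sub_le_sub_left (hy (Or.inl rfl)) z
  have hdisj : (δ • u) ⊓ g = 0 := by
    refine hC' g hg₀ fun a ha => le_antisymm ?_ (le_inf (posPart_nonneg _) hg₀)
    rw [← posPart_sub_inf_posPart_sub (δ • u) (z - (a : E))]
    refine inf_le_inf_left _ (posPart_mono (sub_le_sub_right (sub_le_sub_left ?_ z) _))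
    exact hy (Or.inr (Set.mem_iUnion.mpr ⟨n, a, ha, rfl⟩))
  -- As `g ≤ u` and `δ ≤ 1`, the element `δ g` lies below `δ u ⊓ g = 0`.
  have hδg : δ • g ≤ 0 := by
    rw [← hdisj]
    refine le_inf (smul_le_smul_of_nonneg_left hgu hδ.le) ?_
    simpa using smul_le_smul_of_nonneg_right hδ₁ hg₀
  have h₁ : δ • g = 0 := le_antisymm hδg (smul_nonneg hδ.le hg₀)
  exact (smul_eq_zero.mp h₁).resolve_left hδ.ne'

variable {F : Type u} [AddCommGroup F] [Module ℝ F] [FuzzyRieszSpace F]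

theorem IsFuzzySigmaOrderContinuous.isFuzzyOrderContinuous
    (hE : HasFuzzyCountableSupProperty E) {T : E →ₗ[ℝ] F} (hT : IsFuzzyPositive T)
    (hσ : IsFuzzySigmaOrderContinuous T) : IsFuzzyOrderContinuous T := by
  intro ι _ _ _ x hx
  refine hT.fuzzyOrderConverges (fun y hy => ?_) hx
  rw [decreasesToZero_iff] at hy ⊢
  obtain ⟨hanti, hinf⟩ := hy
  refine ⟨fun a b hab => hT.monotone (hanti hab), ?_, ?_⟩
  · rintro _ ⟨a, rfl⟩
    exact hT _ (hinf.1 ⟨a, rfl⟩)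
  intro h hh
  have hlub : IsLUB (Set.range fun a => -y a) 0 := by
    constructor
    · rintro _ ⟨a, rfl⟩
      exact neg_nonpos.mpr (hinf.1 ⟨a, rfl⟩)
    · intro b hb
      refine neg_nonpos.mp (hinf.2 ?_)
      rintro _ ⟨a, rfl⟩
      exact neg_le.mp (hb ⟨a, rfl⟩)
  obtain ⟨B, hB, hBc, hBsup⟩ := hE _ _ (isSup_iff.mpr hlub)
  rw [isSup_iff] at hBsup
  -- Adding one index makes the countable index set nonempty, so that it can be enumerated.
  obtain ⟨i⟩ := ‹Nonempty ι›
  have : Countable B := hBc.to_subtype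
  choose k hk using fun b : B => hB b.2
  obtain ⟨s, hs⟩ := exists_surjective_nat (Option B)
  let e : ℕ → ι := fun n => (s n).elim i k
  choose m hm₁ hm₂ using fun a b : ι => exists_ge_ge a b
  let c : ℕ → ι := fun n => Nat.rec i (fun n a => m a (e n)) n
  have hc : Monotone c := monotone_nat_of_le_succ fun n => hm₁ _ _
  have hdec : DecreasesToZero fun n => y (c n) := by
    refine decreasesToZero_iff.mpr ⟨hanti.comp_monotone hc, ?_, ?_⟩
    · rintro _ ⟨n, rfl⟩
      exact hinf.1 ⟨_, rfl⟩
    · intro b hb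
      refine neg_nonneg.mp (hBsup.2 fun β hβ => ?_)
      obtain ⟨n, hn⟩ := hs (some ⟨β, hβ⟩)
      have h₁ : k ⟨β, hβ⟩ ≤ c (n + 1) := by
        have h₂ : e n ≤ c (n + 1) := hm₂ _ _
        simpa [e, hn] using h₂
      have h₃ : b ≤ y (k ⟨β, hβ⟩) := (hb ⟨n + 1, rfl⟩).trans (hanti h₁)
      have h₄ : -y (k ⟨β, hβ⟩) = β := hk ⟨β, hβ⟩
      rw [← h₄]
      exact neg_le_neg h₃
  exact (hσ _ hdec.fuzzyOrderConverges).nonpos_of_le fun n => hh ⟨_, rfl⟩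

end Countable

/-! ### The equivalences -/

section Equivalence

variable {E : Type u} [AddCommGroup E] [Module ℝ E] [FuzzyRieszSpace E]

theorem HasFuzzyOrderContinuityProperty.latticeHomsAreOrderContinuous
    (h : HasFuzzyOrderContinuityProperty E) : LatticeHomsAreOrderContinuous E :=
  fun F _ _ _ hF T hT => h F hF T hT.isFuzzyPositive

theorem ClosedIdealsAreBands.hasFuzzyOrderContinuityProperty (h : ClosedIdealsAreBands E) :
    HasFuzzyOrderContinuityProperty E :=
  fun _ _ _ _ hF _ hT _ _ _ _ _ hx =>
    hT.fuzzyOrderConverges (fun _ hy => h.decreasesToZero_map hF hT hy) hx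

theorem ClosedIdealsAreBands.hasFuzzySigmaOrderContinuityProperty (h : ClosedIdealsAreBands E) :
    HasFuzzySigmaOrderContinuityProperty E :=
  fun _ _ _ _ hF _ hT _ hx =>
    hT.fuzzyOrderConverges (fun _ hy => h.decreasesToZero_map hF hT hy) hx

end Equivalence

end FuzzyRiesz

theorem theorem4p11 {E : Type*} [AddCommGroup E] [Module ℝ E] [FuzzyRiesz.FuzzyRieszSpace E] :
    List.TFAE [
      FuzzyRiesz.HasFuzzyOrderContinuityProperty E,
      FuzzyRiesz.LatticeHomsAreOrderContinuous E,
      FuzzyRiesz.ClosedIdealsAreBands E] ∧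
    ((FuzzyRiesz.HasFuzzySigmaOrderContinuityProperty E ∧
        FuzzyRiesz.HasFuzzyCountableSupProperty E) →
      FuzzyRiesz.HasFuzzyOrderContinuityProperty E) ∧
    (FuzzyRiesz.IsFuzzyArchimedean E →
      List.TFAE [
        FuzzyRiesz.HasFuzzyOrderContinuityProperty E,
        FuzzyRiesz.LatticeHomsAreOrderContinuous E,
        FuzzyRiesz.ClosedIdealsAreBands E,
        FuzzyRiesz.HasFuzzySigmaOrderContinuityProperty E ∧
          FuzzyRiesz.HasFuzzyCountableSupProperty E]) := by
  have h12 : FuzzyRiesz.HasFuzzyOrderContinuityProperty E →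
      FuzzyRiesz.LatticeHomsAreOrderContinuous E := fun h => h.latticeHomsAreOrderContinuous
  have h23 : FuzzyRiesz.LatticeHomsAreOrderContinuous E →
      FuzzyRiesz.ClosedIdealsAreBands E := fun h => h.closedIdealsAreBands
  have h31 : FuzzyRiesz.ClosedIdealsAreBands E →
      FuzzyRiesz.HasFuzzyOrderContinuityProperty E := fun h => h.hasFuzzyOrderContinuityProperty
  have h41 : FuzzyRiesz.HasFuzzySigmaOrderContinuityProperty E ∧
      FuzzyRiesz.HasFuzzyCountableSupProperty E →
        FuzzyRiesz.HasFuzzyOrderContinuityProperty E :=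
    fun h F _ _ _ hF T hT =>
      FuzzyRiesz.IsFuzzySigmaOrderContinuous.isFuzzyOrderContinuous h.2 hT (h.1 F hF T hT)
  refine ⟨?_, h41, fun hE => ?_⟩
  · tfae_have 1 → 2 := h12
    tfae_have 2 → 3 := h23
    tfae_have 3 → 1 := h31
    tfae_finish
  · tfae_have 1 → 2 := h12
    tfae_have 2 → 3 := h23
    tfae_have 3 → 1 := h31
    tfae_have 4 → 1 := h41
    tfae_have 3 → 4 := fun h =>
      ⟨h.hasFuzzySigmaOrderContinuityProperty, h.hasFuzzyCountableSupProperty hE⟩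
    tfae_finish
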